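/- **Notation.** Let $n\ge 3$ and $1\le d\le n-2$. Write $x=(x',x_n)=(y,z,x_n)\in\mathbb R^n\equiv\mathbb R^d\times\mathbb R^{n-1-d}\times\mathbb R$ with $x'=(y,z)\in\mathbb R^{n-1}$, let $\vec e_n=(0,\dots,0,1)$, and let $\|\cdot\|$ be the Euclidean norm. For $\rho>0$ and $T\subset\mathbb R^n$ let $\mathcal C_\rho(T):=T+\{(v',v_n)\in\mathbb R^n:\|v'\|\le\rho v_n\}$ be the vertical cone of radius $\rho$ over $T$, and let $T^{\uparrow}:=\{p+\lambda\vec e_n: p\in T,\ \lambda\ge0\}$ be the positive (upward) cylinder over $T$. *Pecker's polynomials* are $P_1(\mathtt y_1,\mathtt t):=\mathtt t-\mathtt y_1$ and $$P_{m+1}(\mathtt y_1,\dots,\mathtt y_{m+1},\mathtt t):=P_m\big(a_1,\dots,a_m,(\mathtt t-(\mathtt y_1+\cdots+\mathtt y_{m+1}))^2\big),\qquad a_k:=\mathtt y_{k+1}(\mathtt y_1+\cdots+\mathtt y_k).$$ Put $C_m:=1-\sqrt{(m-1)/m}$, $\ell(m):=(m+1)2^{m-1}-m^2+m$ and, for $m\ge2$,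 let $$Q_m(\mathtt y_1,\dots,\mathtt y_m,\mathtt t):=\Big(\frac{\mathtt t}{C_m}+\mathtt y_m\Big)^{\ell(m)}(\mathtt y_1\cdots\mathtt y_m)^{2^{m-1}}P_m\Big(\mathtt y_1,\dots,\mathtt y_{m-1},\frac1{\mathtt y_1\cdots\mathtt y_m},\mathtt t\Big),$$ which is a polynomial. For polynomials $h_1,\dots,h_m,h_{m+1}\in\mathbb R[x']$ with $h_{m+1}>1$ on $\mathbb R^{n-1}$ and $\mathbf h:=(h_1,\dots,h_{m+1})$, set $$Q_{\mathbf h}(x',x_n):=h_{m+1}(x')^{2\ell(m+1)+2^{m+1}}\,Q_{m+1}\Big(h_1(x'),\dots,h_m(x'),1,\frac{C_{m+1}x_n^2}{h_{m+1}(x')^2}\Big)\in\mathbb R[x],$$ $$\mathcal A_{\mathbf h}:=\{h_1>0,\dots,h_m>0,\ x_n=0\}\subset\mathbb R^n,\qquad \mathcal S_{\mathbf h}:=\{Q_{\mathbf h}\le0,\ x_n>0\}^{\uparrow}.$$ **Theorem.** Let $g_1,\dots,g_r\in\mathbb R[y]$, let $\varepsilon,\delta>0$, put $m:=r+2(n-1-d)$,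 and let $g_{m+1}\in\mathbb R[x']$ satisfy $g_{m+1}\ge1+\varepsilon\frac{\sqrt{n-d-1}}{\delta}$ on $\mathbb R^{n-1}$. Consider the tuple $$\hat{\mathbf g}_\varepsilon:=(g_1,\dots,g_r,\ x_{d+1}+\varepsilon,\dots,x_{n-1}+\varepsilon,\ \varepsilon-x_{d+1},\dots,\varepsilon-x_{n-1},\ g_{m+1})$$ and write $Q:=Q_{\hat{\mathbf g}_\varepsilon}$, $S:=\mathcal S_{\hat{\mathbf g}_\varepsilon}$ and $$D:=\mathcal A_{\hat{\mathbf g}_\varepsilon}\cap\{x_{d+1}=0,\dots,x_n=0\}=\{g_1>0,\dots,g_r>0,\ x_{d+1}=0,\dots,x_n=0\}\subset\mathbb R^n.$$ Let $P\in\mathbb R[x]$ satisfy $P>1$ on $S$. For each integer $k\ge1$ consider the polynomial map $$f_k:\mathbb R^n\to\mathbb R^n,\quad (y,z,x_n)\mapsto\big(y,\ A(x)z,\ B_k(x)x_n\big),\qquad A:=(1+P^2Q)^2,\quad B_k:=\frac{A+A^k}{2}.$$ Then: 1. for every $k\ge1$ and every $x'\in\mathbb R^{n-1}$, $\ \lim_{x_n\to+\infty}B_k(x',x_n)\,x_n=+\infty$;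 2. $S\subset\mathcal C_\delta(D)$; 3. for every $k\ge1$, $\ D^{\uparrow}\subset f_k(S)\subset\mathcal C_{2\delta}(D)$; 4. for every $\Delta>2\delta$ there exists $k_0\ge1$ such that for all $k\ge k_0$ and all $x\in\mathcal C_\Delta(D)\setminus S$ one has $f_k(x)\in\mathcal C_{2\delta}(\{x\})$. -/

import Mathlib

open Filter Topology
open scoped Pointwise

noncomputable section

namespace PolyCone

/-! Pecker's polynomials and their modification -/

/-- `pecker m y t` is Pecker's polynomial `P_{m+1}(y_1, …, y_{m+1}, t)` (the index is
one more than `m`; the entries of `y : Fin (m + 1) → R` are numbered from `0`), evaluated in a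
commutative ring `R`:
`P_1(y_1, t) = t - y_1` and
`P_{m+1}(y_1, …, y_{m+1}, t) = P_m(a_1, …, a_m, (t - (y_1 + ⋯ + y_{m+1}))^2)` with
`a_k = y_{k+1} (y_1 + ⋯ + y_k)`. -/
def pecker {R : Type*} [CommRing R] : (m : ℕ) → (Fin (m + 1) → R) → R → R
  | 0, y, t => t - y 0
  | m + 1, y, t =>
      pecker m (fun k : Fin (m + 1) => y k.succ * ∑ j ∈ Finset.Iic k.castSucc, y j)
        ((t - ∑ j, y j) ^ 2)

/-- `C_M = 1 - √((M - 1) / M)`. -/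
def peckerConst (M : ℕ) : ℝ := 1 - Real.sqrt (((M : ℝ) - 1) / M)

/-- `ℓ(M) = (M + 1) 2^{M-1} - M² + M` (written so that the subtraction does not truncate). -/
def peckerExp (M : ℕ) : ℕ := (M + 1) * 2 ^ (M - 1) + M - M ^ 2

/-- The modified Pecker polynomial
`Q_M(y_1, …, y_M, t) = (t / C_M + y_M)^{ℓ(M)} w^{2^{M-1}} P_M(y_1, …, y_{M-1}, 1 / w, t)`,
`w = y_1 ⋯ y_M`, for `M = m + 1`. As `P_M` is homogeneous of degree `2^{M-1}`, the denominators are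
cleared by writing the last two factors as `P_M(w y_1, …, w y_{M-1}, 1, w t)`, which is polynomial
in `(y, t)`; see `modPecker_eq` for the original expression. -/
def modPecker (m : ℕ) (y : Fin (m + 1) → ℝ) (t : ℝ) : ℝ :=
  (t / peckerConst (m + 1) + y (Fin.last m)) ^ peckerExp (m + 1) *
    pecker m (Fin.snoc (α := fun _ => ℝ) (fun i : Fin m => (∏ j, y j) * y i.castSucc) 1)
      ((∏ j, y j) * t)

/-- For an admissible tuple `(g_1, …, g_m, G)` of polynomials in `x' = (x_1, …, x_N)`, the polynomial
`G^{2 ℓ(m+1) + 2^{m+1}} Q_{m+1}(g_1, …, g_m, 1, C_{m+1} x_n² / G²)` in `x = (x', x_n)`, `n = N + 1`,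
with its denominators cleared; see `eval_polQ` for the original expression. -/
def polQ {N m : ℕ} (g : Fin m → MvPolynomial (Fin N) ℝ) (G : MvPolynomial (Fin N) ℝ) :
    MvPolynomial (Fin (N + 1)) ℝ :=
  let up : MvPolynomial (Fin N) ℝ → MvPolynomial (Fin (N + 1)) ℝ := MvPolynomial.rename Fin.castSucc
  let xn : MvPolynomial (Fin (N + 1)) ℝ := MvPolynomial.X (Fin.last N)
  let w : MvPolynomial (Fin (N + 1)) ℝ := ∏ j, up (g j)
  (xn ^ 2 + up G ^ 2) ^ peckerExp (m + 1) *
    pecker m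
      (Fin.snoc (α := fun _ => MvPolynomial (Fin (N + 1)) ℝ)
        (fun i : Fin m => up G ^ 2 * (w * up (g i))) (up G ^ 2))
      (MvPolynomial.C (peckerConst (m + 1)) * (w * xn ^ 2))

/-! Points, cylinders and cones in `ℝⁿ`, `n = N + 1` -/

/-- The part `x' = (x_1, …, x_{n-1})` of `x = (x', x_n)`. -/
def base {N : ℕ} (x : EuclideanSpace ℝ (Fin (N + 1))) : EuclideanSpace ℝ (Fin N) :=
  WithLp.toLp 2 fun i => x i.castSucc

/-- The point `(x', t)`. -/
def point {N : ℕ} (x' : EuclideanSpace ℝ (Fin N)) (t : ℝ) : EuclideanSpace ℝ (Fin (N + 1)) :=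
  WithLp.toLp 2 (Fin.snoc (α := fun _ => ℝ) (fun i => x' i) t)

/-- The last vector of the standard basis. -/
def en (N : ℕ) : EuclideanSpace ℝ (Fin (N + 1)) := EuclideanSpace.single (Fin.last N) 1

/-- The value of a polynomial at a point. -/
def ev {n : ℕ} (p : MvPolynomial (Fin n) ℝ) (x : EuclideanSpace ℝ (Fin n)) : ℝ :=
  MvPolynomial.eval (fun i => x i) p

/-- The polynomial map with components `F`. -/
def polyMap {n : ℕ} (F : Fin n → MvPolynomial (Fin n) ℝ) (x : EuclideanSpace ℝ (Fin n)) :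
    EuclideanSpace ℝ (Fin n) :=
  WithLp.toLp 2 fun i => ev (F i) x

/-- The positive cylinder of base `X` in the direction `v`. -/
def posCylinder {n : ℕ} (X : Set (EuclideanSpace ℝ (Fin n))) (v : EuclideanSpace ℝ (Fin n)) :
    Set (EuclideanSpace ℝ (Fin n)) :=
  {p | ∃ x ∈ X, ∃ c : ℝ, 0 ≤ c ∧ p = x + c • v}

/-- The vertical cone `{(v', v_n) : ‖v'‖ ≤ δ v_n}` of radius `δ`. -/
def verticalCone {N : ℕ} (δ : ℝ) : Set (EuclideanSpace ℝ (Fin (N + 1))) :=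
  {v | ‖base v‖ ≤ δ * v (Fin.last N)}

/-- The vertical cone of radius `δ` over `T`. -/
def coneOver {N : ℕ} (δ : ℝ) (T : Set (EuclideanSpace ℝ (Fin (N + 1)))) :
    Set (EuclideanSpace ℝ (Fin (N + 1))) :=
  T + verticalCone δ

/-! Sets associated to an admissible tuple -/

/-- `{g_1 > 0, …, g_m > 0, x_n = 0}`. -/
def setA {N m : ℕ} (g : Fin m → MvPolynomial (Fin N) ℝ) : Set (EuclideanSpace ℝ (Fin (N + 1))) :=
  {x | (∀ i, 0 < ev (g i) (base x)) ∧ x (Fin.last N) = 0}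

/-- The positive vertical cylinder over `{polQ g G ≤ 0, x_n > 0}`. -/
def setS {N m : ℕ} (g : Fin m → MvPolynomial (Fin N) ℝ) (G : MvPolynomial (Fin N) ℝ) :
    Set (EuclideanSpace ℝ (Fin (N + 1))) :=
  posCylinder {x | ev (polQ g G) x ≤ 0 ∧ 0 < x (Fin.last N)} (en N)

/-! The lower-dimensional situation: `ℝⁿ = ℝ^d × ℝ^q × ℝ`, `n = d + q + 1`, `x = (y, z, x_n)` -/

/-- The first `m = r + 2 q` entries of the thickened tuple:
`g_1, …, g_r, x_{d+1} + ε, …, x_{d+q} + ε, ε - x_{d+1}, …, ε - x_{d+q}`. -/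
def thicken {d q r : ℕ} (g : Fin r → MvPolynomial (Fin d) ℝ) (ε : ℝ) :
    Fin (r + q + q) → MvPolynomial (Fin (d + q)) ℝ :=
  Fin.append
    (Fin.append (fun i => MvPolynomial.rename (Fin.castAdd q) (g i))
      (fun j : Fin q => MvPolynomial.X (Fin.natAdd d j) + MvPolynomial.C ε))
    (fun j : Fin q => MvPolynomial.C ε - MvPolynomial.X (Fin.natAdd d j))

/-- The set `D = setA (thicken g ε) ∩ {x_{d+1} = 0, …, x_n = 0}`. -/
def setD {d q r : ℕ} (g : Fin r → MvPolynomial (Fin d) ℝ) (ε : ℝ) :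
    Set (EuclideanSpace ℝ (Fin (d + q + 1))) :=
  setA (thicken (q := q) g ε) ∩
    {x | (∀ j : Fin q, x (Fin.natAdd d j).castSucc = 0) ∧ x (Fin.last (d + q)) = 0}

/-- `A = (1 + P² Q)²`. -/
def polA {n : ℕ} (P Q : MvPolynomial (Fin n) ℝ) : MvPolynomial (Fin n) ℝ := (1 + P ^ 2 * Q) ^ 2

/-- `B_k = (A + A^k) / 2`. -/
def polB {n : ℕ} (P Q : MvPolynomial (Fin n) ℝ) (k : ℕ) : MvPolynomial (Fin n) ℝ :=
  MvPolynomial.C (1 / 2) * (polA P Q + polA P Q ^ k)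

/-- The polynomial map `f_k(y, z, x_n) = (y, A z, B_k x_n)`. -/
def coneMap {d q : ℕ} (P Q : MvPolynomial (Fin (d + q + 1)) ℝ) (k : ℕ) :
    EuclideanSpace ℝ (Fin (d + q + 1)) → EuclideanSpace ℝ (Fin (d + q + 1)) :=
  polyMap
    (Fin.snoc (α := fun _ => MvPolynomial (Fin (d + q + 1)) ℝ)
      (Fin.append (fun i : Fin d => MvPolynomial.X (Fin.castAdd q i).castSucc)
        (fun j : Fin q => polA P Q * MvPolynomial.X (Fin.natAdd d j).castSucc))
      (polB P Q k * MvPolynomial.X (Fin.last (d + q))))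

/-! The polynomials above are the usual ones -/

theorem pecker_smul {R : Type*} [CommRing R] (c : R) (m : ℕ) (y : Fin (m + 1) → R) (t : R) :
    pecker m (fun i => c * y i) (c * t) = c ^ 2 ^ m * pecker m y t := by
  induction m generalizing c t with
  | zero => simp [pecker]; ring
  | succ m ih =>
    have h1 : (c * t - ∑ j, c * y j) ^ 2 = c ^ 2 * (t - ∑ j, y j) ^ 2 := by
      rw [← Finset.mul_sum]; ring
    have h2 : (fun k : Fin (m + 1) => c * y k.succ * ∑ j ∈ Finset.Iic k.castSucc, c * y j) =
        fun k : Fin (m + 1) => c ^ 2 * (y k.succ * ∑ j ∈ Finset.Iic k.castSucc, y j) := by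
      funext k; rw [← Finset.mul_sum]; ring
    simp only [pecker]
    rw [h1, h2, ih, ← pow_mul, pow_succ' 2 m]

theorem map_pecker {R S : Type*} [CommRing R] [CommRing S] (f : R →+* S) (m : ℕ)
    (y : Fin (m + 1) → R) (t : R) :
    f (pecker m y t) = pecker m (fun i => f (y i)) (f t) := by
  induction m generalizing t with
  | zero => simp [pecker]
  | succ m ih => simp only [pecker, ih, map_mul, map_sum, map_pow, map_sub]

theorem modPecker_eq (m : ℕ) (y : Fin (m + 1) → ℝ) (t : ℝ) (hw : ∏ j, y j ≠ 0) :
    modPecker m y t =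
      (t / peckerConst (m + 1) + y (Fin.last m)) ^ peckerExp (m + 1) * (∏ j, y j) ^ 2 ^ m *
        pecker m (Fin.snoc (α := fun _ => ℝ) (fun i : Fin m => y i.castSucc) (1 / ∏ j, y j)) t := by
  rw [modPecker, mul_assoc, ← pecker_smul]
  congr 2
  funext i
  refine Fin.lastCases ?_ (fun i => ?_) i
  · simp [hw]
  · simp

theorem peckerConst_pos (m : ℕ) : 0 < peckerConst (m + 1) := by
  have h : Real.sqrt ((((m + 1 : ℕ) : ℝ) - 1) / (m + 1 : ℕ)) < 1 := by
    rw [Real.sqrt_lt' one_pos, div_lt_iff₀ (by positivity)]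
    push_cast; linarith
  unfold peckerConst; linarith

theorem eval_polQ {N m : ℕ} (g : Fin m → MvPolynomial (Fin N) ℝ) (G : MvPolynomial (Fin N) ℝ)
    (x : EuclideanSpace ℝ (Fin (N + 1))) (hG : ev G (base x) ≠ 0) :
    ev (polQ g G) x =
      ev G (base x) ^ (2 * peckerExp (m + 1) + 2 ^ (m + 1)) *
        modPecker m (Fin.snoc (α := fun _ => ℝ) (fun i => ev (g i) (base x)) 1)
          (x (Fin.last N) ^ 2 * peckerConst (m + 1) / ev G (base x) ^ 2) := by
  have hC := (peckerConst_pos m).ne'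
  have hup : ∀ p : MvPolynomial (Fin N) ℝ,
      MvPolynomial.eval (fun i => x i) (MvPolynomial.rename Fin.castSucc p) = ev p (base x) := by
    intro p
    rw [MvPolynomial.eval_rename]
    rfl
  set γ := ev G (base x) with hγ
  have hprod : ∏ j : Fin (m + 1), (Fin.snoc (α := fun _ => ℝ) (fun i => ev (g i) (base x)) 1 :
      Fin (m + 1) → ℝ) j = ∏ i, ev (g i) (base x) := by
    simp [Fin.prod_univ_castSucc]
  rw [modPecker, hprod]
  set w := ∏ i, ev (g i) (base x) with hw
  have e1 : γ ^ (2 * peckerExp (m + 1) + 2 ^ (m + 1)) =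
      (γ ^ 2) ^ peckerExp (m + 1) * (γ ^ 2) ^ 2 ^ m := by
    rw [pow_add, ← pow_mul, ← pow_mul, pow_succ' 2 m]
  have e2 : ∀ a b c e : ℝ, a * b * (c * e) = (a * c) * (b * e) := by intros; ring
  rw [e1, e2, ← mul_pow, ← pecker_smul]
  unfold ev polQ
  simp only [map_mul, map_pow, map_add, map_pecker, MvPolynomial.eval_X, MvPolynomial.eval_C,
    map_prod, hup]
  rw [← hγ, ← hw]
  congr 2
  · simp; field_simp
  · funext i
    refine Fin.lastCases ?_ (fun i => ?_) i
    · simp [hup, ← hγ]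
    · simp only [Fin.snoc_castSucc, map_mul, map_pow, map_prod, hup, ← hγ, ← hw]
      rfl
  · field_simp

end PolyCone

end

open PolyCone

open PolyCone

theorem sum_Iic_castSucc {n : ℕ} (y : Fin (n + 1) → ℝ) (i : Fin n) :
    ∑ j ∈ Finset.Iic i.castSucc, y j = ∑ j ∈ Finset.Iic i, y j.castSucc := by
  rw [← Fin.map_castSuccEmb_Iic, Finset.sum_map]
  rfl

theorem sum_Iic_castSucc_last {n : ℕ} (y : Fin (n + 2) → ℝ) :
    ∑ j ∈ Finset.Iic (Fin.last n).castSucc, y j = ∑ j : Fin (n + 1), y j.castSucc := by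
  rw [sum_Iic_castSucc]
  congr 1
  ext j
  simp [Fin.le_last]

theorem sq_sum_eq_sum_sq_add {n : ℕ} (y : Fin (n + 1) → ℝ) :
    (∑ j, y j) ^ 2 = ∑ j, y j ^ 2 +
      2 * ∑ k : Fin n, y k.succ * ∑ j ∈ Finset.Iic k.castSucc, y j := by
  induction n with
  | zero => simp
  | succ n ih =>
    have h := ih fun i => y i.castSucc
    rw [Fin.sum_univ_castSucc, Fin.sum_univ_castSucc (fun j => y j ^ 2),
      Fin.sum_univ_castSucc (fun k : Fin (n + 1) => y k.succ * _), sum_Iic_castSucc_last,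
      add_sq, h]
    simp only [sum_Iic_castSucc, ← Fin.succ_castSucc, Fin.succ_last]
    ring

theorem same_sign_of_mul_sum_nonneg {n : ℕ} (y : Fin (n + 1) → ℝ)
    (h : ∀ k : Fin n, 0 ≤ y k.succ * ∑ j ∈ Finset.Iic k.castSucc, y j) :
    (∀ i, 0 ≤ y i) ∨ (∀ i, y i ≤ 0) := by
  induction n with
  | zero =>
    rcases le_total 0 (y 0) with h0 | h0
    · exact .inl fun i => by rwa [Fin.eq_zero i]
    · exact .inr fun i => by rwa [Fin.eq_zero i]
  | succ n ih =>
    have hl := h (Fin.last n)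
    rw [sum_Iic_castSucc_last, Fin.succ_last] at hl
    have hprev := ih (fun i => y i.castSucc) fun k => by
      simpa only [sum_Iic_castSucc, ← Fin.succ_castSucc] using h k.castSucc
    by_cases hz : ∀ i : Fin (n + 1), y i.castSucc = 0
    · rcases le_total 0 (y (Fin.last _)) with h0 | h0
      · exact .inl fun i => Fin.lastCases h0 (fun i => (hz i).ge) i
      · exact .inr fun i => Fin.lastCases h0 (fun i => (hz i).le) i
    · push Not at hz
      obtain ⟨i₀, hi₀⟩ := hz
      rcases hprev with hp | hp
      · have hs : 0 < ∑ j : Fin (n + 1), y j.castSucc :=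
          Finset.sum_pos' (fun i _ => hp i) ⟨i₀, Finset.mem_univ _, (hp i₀).lt_of_ne' hi₀⟩
        exact .inl fun i => Fin.lastCases (nonneg_of_mul_nonneg_left hl hs) hp i
      · have hs : ∑ j : Fin (n + 1), y j.castSucc < 0 :=
          Finset.sum_neg' (fun i _ => hp i) ⟨i₀, Finset.mem_univ _, (hp i₀).lt_of_ne hi₀⟩
        exact .inr fun i => Fin.lastCases (by nlinarith) hp i

/-- Where a Pecker polynomial is nonpositive and `t ≥ 0`, all `y_i` are nonnegative and `t` is
comparable with their sum. -/
theorem pecker_nonpos (m : ℕ) (y : Fin (m + 1) → ℝ) (t : ℝ) (ht : 0 ≤ t)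
    (h : pecker m y t ≤ 0) :
    (∀ i, 0 ≤ y i) ∧ t ≤ 2 * ∑ i, y i ∧
      (1 ≤ m → (t - ∑ i, y i) ^ 2 ≤ (m : ℝ) / (m + 1) * (∑ i, y i) ^ 2) := by
  induction m generalizing t with
  | zero =>
    simp only [pecker] at h
    have h0 : 0 ≤ y 0 := by linarith
    refine ⟨fun i => by rwa [Fin.eq_zero i], ?_, by simp⟩
    simp
    linarith
  | succ m ih =>
    simp only [pecker] at h
    obtain ⟨ha, hu, -⟩ := ih _ _ (sq_nonneg _) h
    have hsq := sq_sum_eq_sum_sq_add y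
    have hcs : (∑ i, y i) ^ 2 ≤ ((m : ℝ) + 2) * ∑ i, y i ^ 2 := by
      have := sq_sum_le_card_mul_sum_sq (s := Finset.univ) (f := y)
      simp only [Finset.card_univ, Fintype.card_fin] at this
      push_cast at this
      rwa [show (m : ℝ) + 1 + 1 = m + 2 by ring] at this
    have hb : (t - ∑ i, y i) ^ 2 ≤ ((m + 1 : ℕ) : ℝ) / ((m + 1 : ℕ) + 1) * (∑ i, y i) ^ 2 := by
      push_cast
      rw [div_mul_eq_mul_div, le_div_iff₀ (by positivity)]
      nlinarith [mul_le_mul_of_nonneg_right hu (by positivity : (0 : ℝ) ≤ (m : ℝ) + 2)]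
    set S := ∑ i, y i with hS
    have hb' : ((m : ℝ) + 2) * (t - S) ^ 2 ≤ ((m : ℝ) + 1) * S ^ 2 := by
      push_cast at hb
      rw [div_mul_eq_mul_div, le_div_iff₀ (by positivity)] at hb
      linarith
    have hnn : ∀ i, 0 ≤ y i := by
      rcases same_sign_of_mul_sum_nonneg y ha with hy | hy
      · exact hy
      · have hS0 : S ≤ 0 := Finset.sum_nonpos fun i _ => hy i
        rcases hS0.lt_or_eq with hlt | heq
        · have h1 : S ^ 2 ≤ (t - S) ^ 2 := by nlinarith
          have h2 : 0 < S ^ 2 := by nlinarith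
          nlinarith [(Nat.cast_nonneg m : (0 : ℝ) ≤ m)]
        · exact fun i => ((Finset.sum_eq_zero_iff_of_nonpos fun i _ => hy i).1 heq i
            (Finset.mem_univ i)).ge
    refine ⟨hnn, ?_, fun _ => hb⟩
    have hS0 : 0 ≤ S := Finset.sum_nonneg fun i _ => hnn i
    have h1 : (t - S) ^ 2 ≤ S ^ 2 := by
      nlinarith [(Nat.cast_nonneg m : (0 : ℝ) ≤ m), sq_nonneg (t - S)]
    linarith [abs_le_of_sq_le_sq' h1 hS0]

theorem prod_mul_sum_Iic_ge {n : ℕ} (y : Fin (n + 2) → ℝ) {μ : ℝ} (hμ : 0 < μ)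
    (hy : ∀ i, μ ≤ y i) :
    (∏ i, y i) * μ ^ n ≤ ∏ k : Fin (n + 1), y k.succ * ∑ j ∈ Finset.Iic k.castSucc, y j := by
  have hpos : ∀ i, 0 < y i := fun i => hμ.trans_le (hy i)
  rw [Finset.prod_mul_distrib, Fin.prod_univ_succ, Fin.prod_univ_succ (fun k : Fin (n + 1) =>
    ∑ j ∈ Finset.Iic k.castSucc, y j)]
  have h0 : ∑ j ∈ Finset.Iic (0 : Fin (n + 1)).castSucc, y j = y 0 := by
    rw [Fin.castSucc_zero, show (Finset.Iic (0 : Fin (n + 2))) = {0} by ext; simp]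
    simp
  rw [h0]
  have h1 : μ ^ n ≤ ∏ k : Fin n, ∑ j ∈ Finset.Iic k.succ.castSucc, y j := by
    rw [← Fin.prod_const]
    refine Finset.prod_le_prod (fun _ _ => hμ.le) fun k _ => (hy k.succ.castSucc).trans ?_
    exact Finset.single_le_sum (f := y) (fun i _ => (hpos i).le) (by simp)
  have h2 : 0 < ∏ i : Fin (n + 1), y i.succ := Finset.prod_pos fun i _ => hpos _
  calc y 0 * (∏ i : Fin (n + 1), y i.succ) * μ ^ n
      = (∏ i : Fin (n + 1), y i.succ) * (y 0 * μ ^ n) := by ring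
    _ ≤ _ := by have := (hpos 0).le; gcongr

theorem succ_le_two_pow (m : ℕ) : m + 1 ≤ 2 ^ m := Nat.lt_two_pow_self

/-- Pecker polynomials take sufficiently negative values when the `y_i` are bounded below. -/
theorem exists_pecker_le (m : ℕ) (y : Fin (m + 1) → ℝ) {μ : ℝ} (hμ : 0 < μ)
    (hy : ∀ i, μ ≤ y i) :
    ∃ t, 0 ≤ t ∧ (1 ≤ m → ∑ i, y i ≤ t) ∧
      pecker m y t ≤ -((∏ i, y i) * μ ^ (2 ^ m - (m + 1))) := by
  induction m generalizing μ with
  | zero => exact ⟨0, le_rfl, by simp, by simp [pecker]⟩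
  | succ m ih =>
    have hpos : ∀ i, 0 < y i := fun i => hμ.trans_le (hy i)
    obtain ⟨u, hu0, -, hu⟩ := ih (fun k : Fin (m + 1) => y k.succ *
      ∑ j ∈ Finset.Iic k.castSucc, y j) (μ := μ * μ) (by positivity) fun k =>
        mul_le_mul (hy _) ((hy k.castSucc).trans
          (Finset.single_le_sum (f := y) (fun i _ => (hpos i).le) (by simp))) hμ.le (hpos _).le
    have hS : 0 ≤ ∑ i, y i := Finset.sum_nonneg fun i _ => (hpos i).le
    refine ⟨∑ i, y i + √u, by positivity, fun _ => by linarith [Real.sqrt_nonneg u], ?_⟩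
    simp only [pecker, add_sub_cancel_left, Real.sq_sqrt hu0]
    refine hu.trans (neg_le_neg ?_)
    have he : 2 ^ (m + 1) - (m + 1 + 1) = m + 2 * (2 ^ m - (m + 1)) := by
      have := succ_le_two_pow m
      rw [pow_succ]
      omega
    rw [he, pow_add, ← mul_assoc, pow_mul, sq]
    have := prod_mul_sum_Iic_ge y hμ hy
    gcongr

theorem peckerConst_lt_one (m : ℕ) (hm : 1 ≤ m) : peckerConst (m + 1) < 1 := by
  have : 0 < Real.sqrt ((((m + 1 : ℕ) : ℝ) - 1) / (m + 1 : ℕ)) := by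
    apply Real.sqrt_pos.2
    push_cast
    have : (0 : ℝ) < m := by exact_mod_cast hm
    rw [add_sub_cancel_right]
    positivity
  unfold peckerConst
  linarith

theorem peckerConst_mul_sum_le (m : ℕ) (hm : 1 ≤ m) (y : Fin (m + 1) → ℝ) (t : ℝ) (ht : 0 ≤ t)
    (h : pecker m y t ≤ 0) : peckerConst (m + 1) * ∑ i, y i ≤ t := by
  obtain ⟨hy, -, hb⟩ := pecker_nonpos m y t ht h
  have hS : 0 ≤ ∑ i, y i := Finset.sum_nonneg fun i _ => hy i
  have hr : (0 : ℝ) ≤ (m : ℝ) / (m + 1) := by positivity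
  have h1 : (t - ∑ i, y i) ^ 2 ≤ (√((m : ℝ) / (m + 1)) * ∑ i, y i) ^ 2 := by
    rw [mul_pow, Real.sq_sqrt hr]
    exact hb hm
  have h2 := (abs_le_of_sq_le_sq' h1 (by positivity)).1
  have hc : peckerConst (m + 1) = 1 - √((m : ℝ) / (m + 1)) := by
    simp [peckerConst]
  rw [hc]
  linarith

theorem one_le_sum_add_inv_prod {m : ℕ} (a : Fin m → ℝ) (ha : ∀ i, 0 < a i) :
    1 ≤ ∑ i, a i + 1 / ∏ i, a i := by
  have hw : 0 < ∏ i, a i := Finset.prod_pos fun i _ => ha i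
  by_cases h : ∃ i, 1 ≤ a i
  · obtain ⟨i, hi⟩ := h
    have h1 := Finset.single_le_sum (f := a) (fun i _ => (ha i).le) (Finset.mem_univ i)
    have : 0 < 1 / ∏ i, a i := by positivity
    linarith
  · push Not at h
    have h1 : ∏ i, a i ≤ 1 := Finset.prod_le_one (fun i _ => (ha i).le) fun i _ => (h i).le
    have h2 : 1 ≤ 1 / ∏ i, a i := by rwa [le_div_iff₀ hw, one_mul]
    have : 0 ≤ ∑ i, a i := Finset.sum_nonneg fun i _ => (ha i).le
    linarith

theorem ev_polQ {N m : ℕ} (g : Fin m → MvPolynomial (Fin N) ℝ) (G : MvPolynomial (Fin N) ℝ)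
    (x : EuclideanSpace ℝ (Fin (N + 1))) :
    ev (polQ g G) x =
      (x (Fin.last N) ^ 2 + ev G (base x) ^ 2) ^ peckerExp (m + 1) *
        pecker m (Fin.snoc (α := fun _ => ℝ)
          (fun i => ev G (base x) ^ 2 * ((∏ j, ev (g j) (base x)) * ev (g i) (base x)))
          (ev G (base x) ^ 2))
          (peckerConst (m + 1) * ((∏ j, ev (g j) (base x)) * x (Fin.last N) ^ 2)) := by
  have hup : ∀ p : MvPolynomial (Fin N) ℝ,
      MvPolynomial.eval (fun i => x i) (MvPolynomial.rename Fin.castSucc p) = ev p (base x) := by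
    intro p
    rw [MvPolynomial.eval_rename]
    rfl
  have hev : ev (polQ g G) x = MvPolynomial.eval (fun i => x i) (polQ g G) := rfl
  rw [hev, polQ]
  simp only [map_mul, map_pow, map_add, map_pecker, MvPolynomial.eval_X, MvPolynomial.eval_C,
    map_prod, hup]
  congr 2
  funext i
  refine Fin.lastCases ?_ (fun i => ?_) i
  · simp [hup]
  · simp [hup]

/-- The points with `Q ≤ 0` and `x_n > 0`: they lie over `{g_1 > 0, …, g_m > 0}`, above the graph
of `G`, and at bounded height. -/
theorem polQ_nonpos {N m : ℕ} (hm : 1 ≤ m) (g : Fin m → MvPolynomial (Fin N) ℝ)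
    (G : MvPolynomial (Fin N) ℝ) (x : EuclideanSpace ℝ (Fin (N + 1)))
    (hG : 0 < ev G (base x)) (hx : 0 < x (Fin.last N)) (h : ev (polQ g G) x ≤ 0) :
    (∀ i, 0 < ev (g i) (base x)) ∧ ev G (base x) ≤ x (Fin.last N) ∧
      x (Fin.last N) ^ 2 ≤ 2 * ev G (base x) ^ 2 *
        (∑ i, ev (g i) (base x) + 1 / ∏ i, ev (g i) (base x)) / peckerConst (m + 1) := by
  have hC := peckerConst_pos m
  rw [ev_polQ] at h
  set γ := ev G (base x)
  set s := x (Fin.last N)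
  set a : Fin m → ℝ := fun i => ev (g i) (base x)
  change _ * pecker m (Fin.snoc (α := fun _ => ℝ) (fun i => γ ^ 2 * ((∏ j, a j) * a i)) (γ ^ 2))
    (peckerConst (m + 1) * ((∏ j, a j) * s ^ 2)) ≤ 0 at h
  change (∀ i, 0 < a i) ∧ _ ∧ _ ≤ 2 * γ ^ 2 * (∑ i, a i + 1 / ∏ i, a i) / _
  set w := ∏ j, a j with hw
  set y : Fin (m + 1) → ℝ :=
    Fin.snoc (α := fun _ => ℝ) (fun i => γ ^ 2 * (w * a i)) (γ ^ 2) with hy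
  have hγ : 0 < γ ^ 2 := by positivity
  have hlast : y (Fin.last m) = γ ^ 2 := by simp [hy]
  have hcast : ∀ i : Fin m, y i.castSucc = γ ^ 2 * (w * a i) := by simp [hy]
  have hp : pecker m y (peckerConst (m + 1) * (w * s ^ 2)) ≤ 0 := by
    have : 0 < (s ^ 2 + γ ^ 2) ^ peckerExp (m + 1) := by positivity
    by_contra hcon
    exact absurd h (not_le.2 (mul_pos this (not_le.1 hcon)))
  have hsum : ∑ i, y i = γ ^ 2 * (w * ∑ i, a i + 1) := by
    rw [Fin.sum_univ_castSucc, hlast]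
    simp only [hcast]
    rw [← Finset.mul_sum, ← Finset.mul_sum]
    ring
  rcases lt_trichotomy w 0 with hneg | hzero | hpos
  · have h1 := pecker_smul (-1) m y (peckerConst (m + 1) * (w * s ^ 2))
    rw [Even.neg_one_pow (Nat.even_pow.2 ⟨even_two, by omega⟩), one_mul] at h1
    have h2 := (pecker_nonpos m (fun i => -1 * y i) (-1 * (peckerConst (m + 1) * (w * s ^ 2)))
      (by nlinarith [mul_pos hC (mul_pos (neg_pos.2 hneg) (by positivity : 0 < s ^ 2))])
      (h1.trans_le hp)).1 (Fin.last m)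
    rw [hlast] at h2
    linarith
  · have h1 := peckerConst_mul_sum_le m hm y _ (by rw [hzero]; simp) hp
    rw [hsum, hzero] at h1
    simp only [zero_mul, zero_add, mul_one, mul_zero] at h1
    exact absurd h1 (not_le.2 (mul_pos hC hγ))
  · have ht : 0 ≤ peckerConst (m + 1) * (w * s ^ 2) := by positivity
    obtain ⟨h1, h2, -⟩ := pecker_nonpos m y _ ht hp
    have h3 := peckerConst_mul_sum_le m hm y _ ht hp
    rw [hsum] at h2 h3
    have ha : ∀ i, 0 < a i := by
      intro i
      have h4 := h1 i.castSucc
      rw [hcast] at h4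
      have h5 : 0 ≤ a i := nonneg_of_mul_nonneg_right (nonneg_of_mul_nonneg_right h4 hγ) hpos
      refine h5.lt_of_ne' fun h0 => hpos.ne' ?_
      exact Finset.prod_eq_zero (Finset.mem_univ i) h0
    have hE : w * ∑ i, a i + 1 = w * (∑ i, a i + 1 / w) := by field_simp
    rw [hE] at h2 h3
    have hone := one_le_sum_add_inv_prod a ha
    rw [← hw] at hone
    refine ⟨ha, ?_, ?_⟩
    · have h4 : γ ^ 2 * (w * (∑ i, a i + 1 / w)) ≤ w * s ^ 2 := le_of_mul_le_mul_left h3 hC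
      have h5 : w * (γ ^ 2 * (∑ i, a i + 1 / w)) ≤ w * s ^ 2 := by linarith
      have h6 := le_of_mul_le_mul_left h5 hpos
      have h7 : γ ^ 2 ≤ s ^ 2 := by nlinarith
      exact le_of_sq_le_sq h7 hx.le
    · rw [le_div_iff₀ hC]
      have h5 : w * (s ^ 2 * peckerConst (m + 1)) ≤
          w * (2 * γ ^ 2 * (∑ i, a i + 1 / w)) := by linarith
      exact le_of_mul_le_mul_left h5 hpos

theorem base_point {N : ℕ} (x' : EuclideanSpace ℝ (Fin N)) (t : ℝ) : base (point x' t) = x' := by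
  ext i
  simp [base, point]

theorem point_last {N : ℕ} (x' : EuclideanSpace ℝ (Fin N)) (t : ℝ) :
    point x' t (Fin.last N) = t := by
  simp [point]

theorem eventually_polQ_pos {N m : ℕ} (hm : 1 ≤ m) (g : Fin m → MvPolynomial (Fin N) ℝ)
    (G : MvPolynomial (Fin N) ℝ) (x' : EuclideanSpace ℝ (Fin N)) (hG : 0 < ev G x') :
    ∀ᶠ t : ℝ in atTop, 0 < ev (polQ g G) (point x' t) := by
  set K := 2 * ev G x' ^ 2 * (∑ i, ev (g i) x' + 1 / ∏ i, ev (g i) x') / peckerConst (m + 1)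
    with hK
  filter_upwards [eventually_gt_atTop (max 1 K)] with t ht
  by_contra hcon
  have h1 : 1 < t := (le_max_left _ _).trans_lt ht
  have h2 : K < t := (le_max_right _ _).trans_lt ht
  have h3 := (polQ_nonpos hm g G (point x' t) (by rwa [base_point])
    (by rw [point_last]; linarith) (not_lt.1 hcon)).2.2
  rw [base_point, point_last, ← hK] at h3
  nlinarith

theorem peckerExp_eq (m : ℕ) :
    peckerExp (m + 1) = 2 ^ m + (2 ^ m + m * (2 ^ m - (m + 1))) := by
  obtain ⟨c, hc⟩ := Nat.exists_eq_add_of_le (succ_le_two_pow m)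
  simp only [peckerExp, Nat.add_sub_cancel]
  rw [hc, Nat.add_sub_cancel_left]
  apply Nat.sub_eq_of_eq_add
  ring

theorem exists_polQ_le_neg_one {N m : ℕ} (hm : 1 ≤ m) (g : Fin m → MvPolynomial (Fin N) ℝ)
    (G : MvPolynomial (Fin N) ℝ) (x' : EuclideanSpace ℝ (Fin N)) (hG : 1 ≤ ev G x')
    (hg : ∀ i, 0 < ev (g i) x') :
    ∃ s : ℝ, 0 < s ∧ ev (polQ g G) (point x' s) ≤ -1 := by
  have hC := peckerConst_pos m
  have hC1 := peckerConst_lt_one m hm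
  set γ := ev G x' with hγ
  set a : Fin m → ℝ := fun i => ev (g i) x' with ha
  set w := ∏ i, a i with hw
  have hwpos : 0 < w := Finset.prod_pos fun i _ => hg i
  set y : Fin (m + 1) → ℝ := Fin.snoc (α := fun _ => ℝ) a (1 / w) with hy
  have hypos : ∀ i, 0 < y i := by
    intro i
    refine Fin.lastCases ?_ (fun i => ?_) i
    · simpa [hy] using hwpos
    · simpa [hy] using hg i
  have hyprod : ∏ i, y i = 1 := by
    rw [Fin.prod_univ_castSucc]
    simp only [hy, Fin.snoc_castSucc, Fin.snoc_last, ← hw]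
    field_simp
  set U := 1 + ∑ i, y i with hU
  have hU1 : 1 ≤ U := by
    have : 0 ≤ ∑ i, y i := Finset.sum_nonneg fun i _ => (hypos i).le
    linarith
  have hyU : ∀ i, y i ≤ U := fun i => by
    have := Finset.single_le_sum (f := y) (fun i _ => (hypos i).le) (Finset.mem_univ i)
    linarith
  have hμ : ∀ i, (U ^ m)⁻¹ ≤ y i := by
    intro i
    have h1 : y i * ∏ j ∈ Finset.univ.erase i, y j = 1 := by
      rw [Finset.mul_prod_erase _ _ (Finset.mem_univ i), hyprod]
    have h2 : ∏ j ∈ Finset.univ.erase i, y j ≤ U ^ m := by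
      have := Finset.prod_le_prod (s := Finset.univ.erase i) (g := fun _ => U)
        (fun j _ => (hypos j).le) fun j _ => hyU j
      simpa using this
    rw [inv_le_iff_one_le_mul₀ (by positivity)]
    calc 1 = y i * ∏ j ∈ Finset.univ.erase i, y j := h1.symm
      _ ≤ y i * U ^ m := mul_le_mul_of_nonneg_left h2 (hypos i).le
  obtain ⟨t, -, htS, htp⟩ := exists_pecker_le m y (by positivity) hμ
  replace htS := htS hm
  rw [hyprod, one_mul] at htp
  have htpos : 0 < t := (Finset.sum_pos (fun i _ => hypos i) ⟨0, Finset.mem_univ _⟩).trans_le htS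
  have hγ0 : 0 < γ := by linarith
  have hsq : √(t / peckerConst (m + 1)) ^ 2 = t / peckerConst (m + 1) :=
    Real.sq_sqrt (by positivity)
  refine ⟨γ * √(t / peckerConst (m + 1)), by positivity, ?_⟩
  rw [eval_polQ _ _ _ (by rw [base_point]; exact hγ0.ne'), base_point, point_last, ← hγ]
  have harg : (γ * √(t / peckerConst (m + 1))) ^ 2 * peckerConst (m + 1) / γ ^ 2 = t := by
    rw [mul_pow, hsq]
    field_simp
  have hprod1 : ∏ j, (Fin.snoc (α := fun _ => ℝ) a 1 : Fin (m + 1) → ℝ) j = w := by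
    simp [Fin.prod_univ_castSucc, hw]
  rw [harg, modPecker_eq _ _ _ (by rw [hprod1]; exact hwpos.ne'), hprod1]
  have hyy : (Fin.snoc (α := fun _ => ℝ)
      (fun i : Fin m => (Fin.snoc (α := fun _ => ℝ) a 1 : Fin (m + 1) → ℝ) i.castSucc) (1 / w) :
      Fin (m + 1) → ℝ) = y := by
    simp [hy]
  rw [hyy]
  simp only [Fin.snoc_last]
  set T := t / peckerConst (m + 1) + 1 with hT
  have hUT : U ≤ T := by
    have : t ≤ t / peckerConst (m + 1) := by
      rw [le_div_iff₀ hC]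
      nlinarith
    linarith
  have hwU : w⁻¹ ≤ U := by
    have := hyU (Fin.last m)
    simpa [hy] using this
  have hwU' : 1 ≤ w * U := by rwa [inv_le_iff_one_le_mul₀' hwpos] at hwU
  set e := 2 ^ m - (m + 1) with he
  have key : 1 ≤ T ^ peckerExp (m + 1) * w ^ 2 ^ m * ((U ^ m)⁻¹) ^ e := by
    have h1 : U ^ peckerExp (m + 1) ≤ T ^ peckerExp (m + 1) := by gcongr
    have h2 : U ^ peckerExp (m + 1) * w ^ 2 ^ m * ((U ^ m)⁻¹) ^ e = (w * U) ^ 2 ^ m * U ^ 2 ^ m := by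
      have hU0 : U ≠ 0 := by positivity
      rw [peckerExp_eq, ← he, pow_add, pow_add, pow_mul, mul_pow, inv_pow]
      field_simp
    calc (1 : ℝ) ≤ (w * U) ^ 2 ^ m * U ^ 2 ^ m :=
          by nlinarith [one_le_pow₀ hwU' (n := 2 ^ m), one_le_pow₀ hU1 (n := 2 ^ m)]
      _ = _ := h2.symm
      _ ≤ _ := by gcongr
  have hγp : 1 ≤ γ ^ (2 * peckerExp (m + 1) + 2 ^ (m + 1)) := one_le_pow₀ hG
  have hTp : 0 ≤ T ^ peckerExp (m + 1) * w ^ 2 ^ m := by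
    have : 0 ≤ T := by linarith
    positivity
  have h3 : T ^ peckerExp (m + 1) * w ^ 2 ^ m * pecker m y t ≤ -1 := by
    have := mul_le_mul_of_nonneg_left htp hTp
    linarith
  nlinarith

theorem base_add {N : ℕ} (x v : EuclideanSpace ℝ (Fin (N + 1))) :
    base (x + v) = base x + base v := by
  ext i
  simp [base]

theorem mem_coneOver {N : ℕ} {δ : ℝ} {T : Set (EuclideanSpace ℝ (Fin (N + 1)))}
    {p : EuclideanSpace ℝ (Fin (N + 1))} :
    p ∈ coneOver δ T ↔
      ∃ x ∈ T, ‖base p - base x‖ ≤ δ * (p (Fin.last N) - x (Fin.last N)) := by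
  constructor
  · rintro ⟨x, hx, v, hv, rfl⟩
    refine ⟨x, hx, ?_⟩
    simpa [base_add, verticalCone] using hv
  · rintro ⟨x, hx, h⟩
    refine ⟨x, hx, p - x, ?_, by simp⟩
    have h1 : base (p - x) = base p - base x := by
      ext i
      simp [base]
    simpa [verticalCone, h1] using h

theorem point_base_last {N : ℕ} (x : EuclideanSpace ℝ (Fin (N + 1))) :
    point (base x) (x (Fin.last N)) = x := by
  ext i
  refine Fin.lastCases ?_ (fun i => ?_) i
  · simp [point]
  · simp [point, base]

theorem point_add_smul_en {N : ℕ} (x' : EuclideanSpace ℝ (Fin N)) (s c : ℝ) :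
    point x' s + c • en N = point x' (s + c) := by
  ext i
  refine Fin.lastCases ?_ (fun i => ?_) i
  · simp [point, en]
  · simp [point, en]

theorem continuous_ev_point {N : ℕ} (p : MvPolynomial (Fin (N + 1)) ℝ)
    (x' : EuclideanSpace ℝ (Fin N)) : Continuous fun t : ℝ => ev p (point x' t) := by
  refine (MvPolynomial.continuous_eval p).comp (continuous_pi fun i => ?_)
  refine Fin.lastCases ?_ (fun i => ?_) i
  · simpa [point] using continuous_id'
  · simpa [point] using continuous_const

theorem mem_setS {N m : ℕ} {g : Fin m → MvPolynomial (Fin N) ℝ} {G : MvPolynomial (Fin N) ℝ}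
    {x : EuclideanSpace ℝ (Fin (N + 1))} :
    x ∈ setS g G ↔
      ∃ s : ℝ, 0 < s ∧ s ≤ x (Fin.last N) ∧ ev (polQ g G) (point (base x) s) ≤ 0 := by
  constructor
  · rintro ⟨u, ⟨hQ, hu⟩, c, hc, rfl⟩
    refine ⟨u (Fin.last N), hu, by simpa [en] using hc, ?_⟩
    rw [← point_base_last u, point_add_smul_en, base_point, point_base_last,
      point_base_last]
    exact hQ
  · rintro ⟨s, hs, hsx, hQ⟩
    refine ⟨point (base x) s, ⟨hQ, by rwa [point_last]⟩, x (Fin.last N) - s, by linarith, ?_⟩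
    rw [point_add_smul_en, add_sub_cancel, point_base_last]

theorem ev_polA {n : ℕ} (P Q : MvPolynomial (Fin n) ℝ) (x : EuclideanSpace ℝ (Fin n)) :
    ev (polA P Q) x = (1 + ev P x ^ 2 * ev Q x) ^ 2 := by
  simp [ev, polA]

theorem ev_polB {n : ℕ} (P Q : MvPolynomial (Fin n) ℝ) (k : ℕ) (x : EuclideanSpace ℝ (Fin n)) :
    ev (polB P Q k) x = (ev (polA P Q) x + ev (polA P Q) x ^ k) / 2 := by
  simp only [ev, polB, map_mul, map_add, map_pow, MvPolynomial.eval_C]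
  ring

theorem ev_polA_nonneg {n : ℕ} (P Q : MvPolynomial (Fin n) ℝ) (x : EuclideanSpace ℝ (Fin n)) :
    0 ≤ ev (polA P Q) x := by
  rw [ev_polA]
  positivity

theorem one_le_ev_polA {n : ℕ} (P Q : MvPolynomial (Fin n) ℝ) (x : EuclideanSpace ℝ (Fin n))
    (h : 0 ≤ ev Q x) : 1 ≤ ev (polA P Q) x := by
  rw [ev_polA]
  have : 0 ≤ ev P x ^ 2 * ev Q x := by positivity
  nlinarith

theorem tendsto_polB_mul {N m : ℕ} (hm : 1 ≤ m) (g : Fin m → MvPolynomial (Fin N) ℝ)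
    (G : MvPolynomial (Fin N) ℝ) (P : MvPolynomial (Fin (N + 1)) ℝ) (k : ℕ)
    (x' : EuclideanSpace ℝ (Fin N)) (hG : 0 < ev G x') :
    Tendsto (fun t : ℝ => ev (polB P (polQ g G) k) (point x' t) * t) atTop atTop := by
  refine tendsto_atTop_mono' atTop ?_ tendsto_id
  filter_upwards [eventually_polQ_pos hm g G x' hG, eventually_ge_atTop 0] with t ht ht0
  have hA := one_le_ev_polA P (polQ g G) (point x' t) ht.le
  have hAk := one_le_pow₀ hA (n := k)
  rw [ev_polB, id]
  nlinarith

/-- The part `z` of `x' = (y, z)`. -/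
def zPart {d q : ℕ} (v : EuclideanSpace ℝ (Fin (d + q))) : EuclideanSpace ℝ (Fin q) :=
  WithLp.toLp 2 fun j => v (Fin.natAdd d j)

/-- The projection `(y, z) ↦ (y, 0)`. -/
def yProj {d q : ℕ} (v : EuclideanSpace ℝ (Fin (d + q))) : EuclideanSpace ℝ (Fin (d + q)) :=
  WithLp.toLp 2 (Fin.append (fun i => v (Fin.castAdd q i)) 0)

theorem norm_zPart_le {d q : ℕ} (v : EuclideanSpace ℝ (Fin (d + q))) : ‖zPart v‖ ≤ ‖v‖ := by
  apply le_of_sq_le_sq _ (norm_nonneg _)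
  rw [EuclideanSpace.real_norm_sq_eq, EuclideanSpace.real_norm_sq_eq, Fin.sum_univ_add]
  simp only [zPart]
  have : 0 ≤ ∑ i : Fin d, v (Fin.castAdd q i) ^ 2 := by positivity
  linarith

theorem norm_eq_norm_zPart {d q : ℕ} (v : EuclideanSpace ℝ (Fin (d + q)))
    (h : ∀ i, v (Fin.castAdd q i) = 0) : ‖v‖ = ‖zPart v‖ := by
  rw [EuclideanSpace.norm_eq, EuclideanSpace.norm_eq, Fin.sum_univ_add]
  simp [zPart, h]

theorem norm_sub_yProj {d q : ℕ} (v : EuclideanSpace ℝ (Fin (d + q))) :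
    ‖v - yProj v‖ = ‖zPart v‖ := by
  rw [norm_eq_norm_zPart _ (by simp [yProj])]
  congr 1
  ext j
  simp [yProj, zPart]

theorem norm_zPart_le_of_abs_le {d q : ℕ} (v : EuclideanSpace ℝ (Fin (d + q))) {ε : ℝ}
    (hε : 0 ≤ ε) (h : ∀ j, |v (Fin.natAdd d j)| ≤ ε) : ‖zPart v‖ ≤ ε * √q := by
  apply le_of_sq_le_sq _ (by positivity)
  rw [EuclideanSpace.real_norm_sq_eq, mul_pow, Real.sq_sqrt (by positivity)]
  calc ∑ j, zPart v j ^ 2 ≤ ∑ _j : Fin q, ε ^ 2 := by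
        refine Finset.sum_le_sum fun j _ => sq_le_sq' ?_ ?_
        · exact (abs_le.1 (h j)).1
        · exact (abs_le.1 (h j)).2
    _ = ε ^ 2 * q := by simp; ring

theorem thicken_pos_iff {d q r : ℕ} (g : Fin r → MvPolynomial (Fin d) ℝ) (ε : ℝ)
    (v : EuclideanSpace ℝ (Fin (d + q))) :
    (∀ i, 0 < ev (thicken g ε i) v) ↔
      (∀ i, 0 < MvPolynomial.eval (fun j => v (Fin.castAdd q j)) (g i)) ∧
        ∀ j : Fin q, |v (Fin.natAdd d j)| < ε := by
  rw [Fin.forall_fin_add]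
  simp only [abs_lt]
  rw [Fin.forall_fin_add]
  simp only [thicken, Fin.append_left, Fin.append_right, ev, MvPolynomial.eval_rename, map_add,
    map_sub, MvPolynomial.eval_X, MvPolynomial.eval_C]
  constructor
  · rintro ⟨⟨h1, h2⟩, h3⟩
    exact ⟨h1, fun j => ⟨by linarith [h2 j], by linarith [h3 j]⟩⟩
  · rintro ⟨h1, h2⟩
    exact ⟨⟨h1, fun j => by linarith [(h2 j).1]⟩, fun j => by linarith [(h2 j).2]⟩

theorem mem_setD {d q r : ℕ} {g : Fin r → MvPolynomial (Fin d) ℝ} {ε : ℝ} (hε : 0 < ε)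
    {x : EuclideanSpace ℝ (Fin (d + q + 1))} :
    x ∈ setD (q := q) g ε ↔
      (∀ i, 0 < MvPolynomial.eval (fun j => base x (Fin.castAdd q j)) (g i)) ∧
        zPart (base x) = 0 ∧ x (Fin.last (d + q)) = 0 := by
  have hz : zPart (base x) = 0 ↔ ∀ j : Fin q, x (Fin.natAdd d j).castSucc = 0 := by
    constructor
    · exact fun h j => congrArg (fun v => v j) h
    · exact fun h => by ext j; exact h j
  simp only [setD, setA, Set.mem_inter_iff, Set.mem_ofPred_eq, thicken_pos_iff, hz]
  constructor
  · rintro ⟨⟨⟨h1, -⟩, -⟩, h2, h3⟩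
    exact ⟨h1, h2, h3⟩
  · rintro ⟨h1, h2, h3⟩
    refine ⟨⟨⟨h1, fun j => ?_⟩, h3⟩, h2, h3⟩
    change |x (Fin.natAdd d j).castSucc| < ε
    rwa [h2 j, abs_zero]

theorem point_yProj_mem_setD {d q r : ℕ} {g : Fin r → MvPolynomial (Fin d) ℝ} {ε : ℝ}
    (hε : 0 < ε) {v : EuclideanSpace ℝ (Fin (d + q))}
    (h : ∀ i, 0 < MvPolynomial.eval (fun j => v (Fin.castAdd q j)) (g i)) :
    point (yProj v) 0 ∈ setD (q := q) g ε := by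
  rw [mem_setD hε, base_point, point_last]
  refine ⟨fun i => by simpa [yProj] using h i, ?_, rfl⟩
  ext j
  simp [zPart, yProj]

section coneMap

variable {d q : ℕ} (P Q : MvPolynomial (Fin (d + q + 1)) ℝ) (k : ℕ)
  (x : EuclideanSpace ℝ (Fin (d + q + 1)))

theorem coneMap_last :
    coneMap P Q k x (Fin.last _) = ev (polB P Q k) x * x (Fin.last _) := by
  simp [coneMap, polyMap, ev]

theorem base_coneMap_castAdd (i : Fin d) :
    base (coneMap P Q k x) (Fin.castAdd q i) = base x (Fin.castAdd q i) := by
  simp only [base, coneMap, polyMap, Fin.snoc_castSucc, Fin.append_left, ev, MvPolynomial.eval_X]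

theorem zPart_base_coneMap :
    zPart (base (coneMap P Q k x)) = ev (polA P Q) x • zPart (base x) := by
  ext j
  simp only [base, coneMap, polyMap, zPart, Fin.snoc_castSucc, Fin.append_right, ev, map_mul,
    MvPolynomial.eval_X, PiLp.smul_apply, smul_eq_mul]

theorem yProj_base_coneMap : yProj (base (coneMap P Q k x)) = yProj (base x) := by
  ext i
  refine Fin.addCases (fun i => ?_) (fun j => ?_) i
  · simpa [yProj] using base_coneMap_castAdd P Q k x i
  · simp [yProj]

theorem norm_base_coneMap_sub :
    ‖base (coneMap P Q k x) - base x‖ = |ev (polA P Q) x - 1| * ‖zPart (base x)‖ := by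
  rw [norm_eq_norm_zPart _ fun i => by
      rw [PiLp.sub_apply, base_coneMap_castAdd, sub_self], ← Real.norm_eq_abs, ← norm_smul,
    sub_smul, one_smul, ← zPart_base_coneMap]
  rfl

end coneMap

/-- On `S` the polynomials `g_i(y)` are positive and `‖z‖ ≤ δ x_n`. -/
theorem pos_and_norm_zPart_le_of_mem_setS {d q r : ℕ} (hq : 1 ≤ q)
    {g : Fin r → MvPolynomial (Fin d) ℝ} {G : MvPolynomial (Fin (d + q)) ℝ} {ε δ : ℝ}
    (hε : 0 < ε) (hδ : 0 < δ)
    (hG : ∀ x' : EuclideanSpace ℝ (Fin (d + q)), 1 + ε * (√q / δ) ≤ ev G x')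
    {x : EuclideanSpace ℝ (Fin (d + q + 1))} (hx : x ∈ setS (thicken (q := q) g ε) G) :
    (∀ i, 0 < MvPolynomial.eval (fun j => base x (Fin.castAdd q j)) (g i)) ∧
      0 < x (Fin.last _) ∧ ‖zPart (base x)‖ ≤ δ * x (Fin.last _) := by
  obtain ⟨s, hs, hsx, hQ⟩ := mem_setS.1 hx
  have hGx := hG (base x)
  have hpos : 0 ≤ ε * (√q / δ) := by positivity
  obtain ⟨hg, hGs, -⟩ := polQ_nonpos (by omega) _ G (point (base x) s)
    (by rw [base_point]; linarith) (by rwa [point_last]) hQ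
  rw [base_point] at hg hGs
  rw [point_last] at hGs
  obtain ⟨hg1, hg2⟩ := (thicken_pos_iff g ε _).1 hg
  refine ⟨hg1, hs.trans_le hsx, (norm_zPart_le_of_abs_le _ hε.le fun j => (hg2 j).le).trans ?_⟩
  have h1 : ε * (√q / δ) ≤ x (Fin.last _) := by linarith
  calc ε * √q = δ * (ε * (√q / δ)) := by field_simp
    _ ≤ _ := mul_le_mul_of_nonneg_left h1 hδ.le

/-- Over a point where all `g_i` are positive, `B_k x_n` takes all nonnegative values on `S`. -/
theorem exists_mem_setS_polB_mul_eq {N m : ℕ} (hm : 1 ≤ m) (g : Fin m → MvPolynomial (Fin N) ℝ)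
    (G : MvPolynomial (Fin N) ℝ) (P : MvPolynomial (Fin (N + 1)) ℝ)
    (hP : ∀ x ∈ setS g G, 1 < ev P x) {k : ℕ} (hk : 1 ≤ k) (x' : EuclideanSpace ℝ (Fin N))
    (hG : 1 ≤ ev G x') (hg : ∀ i, 0 < ev (g i) x') {c : ℝ} (hc : 0 ≤ c) :
    ∃ t, point x' t ∈ setS g G ∧ ev (polB P (polQ g G) k) (point x' t) * t = c := by
  obtain ⟨s, hs, hQs⟩ := exists_polQ_le_neg_one hm g G x' hG hg
  have hS : ∀ t, s ≤ t → point x' t ∈ setS g G := fun t ht => by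
    rw [mem_setS, base_point, point_last]
    exact ⟨s, hs, ht, by linarith⟩
  have hPs := hP _ (hS s le_rfl)
  obtain ⟨T, hT⟩ := ((eventually_polQ_pos hm g G x' (by linarith)).and
    (eventually_ge_atTop s)).exists
  set φ : ℝ → ℝ := fun t => 1 + ev P (point x' t) ^ 2 * ev (polQ g G) (point x' t) with hφ
  have hφc : Continuous φ := continuous_const.add
    (((continuous_ev_point P x').pow 2).mul (continuous_ev_point (polQ g G) x'))
  have hφs : φ s ≤ 0 := by
    have : 1 ≤ ev P (point x' s) ^ 2 := by nlinarith
    simp only [hφ]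
    nlinarith
  have hφT : 0 ≤ φ T := by
    have := mul_nonneg (sq_nonneg (ev P (point x' T))) hT.1.le
    simp only [hφ]
    linarith
  obtain ⟨t₀, ⟨hst, -⟩, ht₀⟩ := intermediate_value_Icc hT.2 hφc.continuousOn ⟨hφs, hφT⟩
  set ψ : ℝ → ℝ := fun t => ev (polB P (polQ g G) k) (point x' t) * t with hψ
  have hψc : Continuous ψ := (continuous_ev_point _ x').mul continuous_id
  have hψ0 : ψ t₀ = 0 := by
    have hA : ev (polA P (polQ g G)) (point x' t₀) = 0 := by
      rw [ev_polA]
      change φ t₀ ^ 2 = 0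
      rw [ht₀]
      simp
    simp only [hψ]
    rw [ev_polB, hA, zero_pow (by omega)]
    simp
  obtain ⟨T', hT'⟩ := (((tendsto_polB_mul hm g G P k x' (by linarith)).eventually_ge_atTop c).and
    (eventually_ge_atTop t₀)).exists
  obtain ⟨t, ⟨htt, -⟩, ht⟩ := intermediate_value_Icc hT'.2 hψc.continuousOn
    ⟨hψ0.trans_le hc, hT'.1⟩
  exact ⟨t, hS t (hst.trans htt), ht⟩

theorem abs_sub_one_mul_le {A Δ δ s ζ : ℝ} {k : ℕ} (hδ : 0 < δ) (hA : 1 ≤ A) (hs : 0 ≤ s)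
    (hζ : ζ ≤ Δ * s) (hk : Δ ≤ k * δ) :
    |A - 1| * ζ ≤ 2 * δ * ((A + A ^ k) / 2 * s - s) := by
  have hbern : 1 + (k : ℝ) * (A - 1) ≤ A ^ k := by
    simpa using one_add_mul_le_pow (by linarith : -2 ≤ A - 1) k
  have hA0 : 0 ≤ A - 1 := by linarith
  have hAs : 0 ≤ (A - 1) * s := mul_nonneg hA0 hs
  rw [abs_of_nonneg hA0]
  calc (A - 1) * ζ ≤ (A - 1) * (Δ * s) := by gcongr
    _ = Δ * ((A - 1) * s) := by ring
    _ ≤ (k * δ) * ((A - 1) * s) := by gcongr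
    _ ≤ (k * δ) * ((A - 1) * s) + δ * ((A - 1) * s) := by
      linarith [mul_nonneg hδ.le hAs]
    _ = δ * s * ((A - 1) + (1 + k * (A - 1)) - 1) := by ring
    _ ≤ δ * s * ((A - 1) + A ^ k - 1) := by gcongr
    _ = _ := by ring

theorem theorem3p6 (d q r : ℕ) (hd : 1 ≤ d) (hq : 1 ≤ q)
    (g : Fin r → MvPolynomial (Fin d) ℝ)
    (G : MvPolynomial (Fin (d + q)) ℝ)
    (P : MvPolynomial (Fin (d + q + 1)) ℝ)
    (ε δ : ℝ) (hε : 0 < ε) (hδ : 0 < δ)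
    (hG : ∀ x' : EuclideanSpace ℝ (Fin (d + q)), 1 + ε * (Real.sqrt q / δ) ≤ ev G x')
    (hP : ∀ x ∈ setS (thicken (q := q) g ε) G, 1 < ev P x) :
    (∀ k : ℕ, 1 ≤ k → ∀ x' : EuclideanSpace ℝ (Fin (d + q)),
      Tendsto (fun t : ℝ => ev (polB P (polQ (thicken g ε) G) k) (point x' t) * t) atTop atTop) ∧
    setS (thicken g ε) G ⊆ coneOver δ (setD (q := q) g ε) ∧
    (∀ k : ℕ, 1 ≤ k →
      posCylinder (setD g ε) (en (d + q)) ⊆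
        coneMap P (polQ (thicken g ε) G) k '' setS (thicken g ε) G ∧
      coneMap P (polQ (thicken g ε) G) k '' setS (thicken g ε) G ⊆
        coneOver (2 * δ) (setD g ε)) ∧
    (∀ Δ : ℝ, 2 * δ < Δ → ∃ k₀ : ℕ, 1 ≤ k₀ ∧ ∀ k : ℕ, k₀ ≤ k →
      ∀ x ∈ coneOver Δ (setD g ε) \ setS (thicken g ε) G,
        coneMap P (polQ (thicken g ε) G) k x ∈ coneOver (2 * δ) {x}) := by
  have hG1 : ∀ x' : EuclideanSpace ℝ (Fin (d + q)), 1 ≤ ev G x' := fun x' => by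
    have : 0 ≤ ε * (√q / δ) := by positivity
    linarith [hG x']
  have hm : 1 ≤ r + q + q := by omega
  refine ⟨fun k _ x' => tendsto_polB_mul hm _ G P k x' (by linarith [hG1 x']), ?_, ?_, ?_⟩
  · intro x hx
    obtain ⟨hg, -, hz⟩ := pos_and_norm_zPart_le_of_mem_setS hq hε hδ hG hx
    refine mem_coneOver.2 ⟨_, point_yProj_mem_setD hε hg, ?_⟩
    rwa [base_point, norm_sub_yProj, point_last, sub_zero]
  · intro k hk
    constructor
    · rintro _ ⟨u, hu, c, hc, rfl⟩
      have hu' := (mem_setD hε).1 hu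
      obtain ⟨t, htS, ht⟩ := exists_mem_setS_polB_mul_eq hm _ G P hP hk (base u) (hG1 _) hu.1.1 hc
      refine ⟨_, htS, ?_⟩
      rw [← point_base_last (coneMap P _ k _), coneMap_last, point_last, ht,
        ← point_base_last u, point_add_smul_en, base_point, hu'.2.2, zero_add]
      congr 1
      ext i
      refine Fin.addCases (fun i => ?_) (fun j => ?_) i
      · rw [base_coneMap_castAdd, base_point]
      · have h1 := congrArg (fun v => v j) (zPart_base_coneMap P (polQ (thicken g ε) G) k
          (point (base u) t))
        rw [base_point, hu'.2.1, smul_zero, ← hu'.2.1] at h1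
        exact h1
    · rintro _ ⟨x, hx, rfl⟩
      obtain ⟨hg, hx0, hz⟩ := pos_and_norm_zPart_le_of_mem_setS hq hε hδ hG hx
      refine mem_coneOver.2 ⟨_, point_yProj_mem_setD hε hg, ?_⟩
      have hA := ev_polA_nonneg P (polQ (thicken g ε) G) x
      rw [base_point, ← yProj_base_coneMap P (polQ (thicken g ε) G) k x, norm_sub_yProj,
        zPart_base_coneMap, norm_smul, Real.norm_of_nonneg hA, point_last, sub_zero, coneMap_last,
        ev_polB]
      have hAk := pow_nonneg hA k
      nlinarith [mul_le_mul_of_nonneg_left hz hA, mul_nonneg (mul_nonneg hAk hδ.le) hx0.le]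
  · intro Δ hΔ
    obtain ⟨k₀, hk₀⟩ := exists_nat_ge (Δ / δ)
    refine ⟨max 1 k₀, le_max_left _ _, fun k hk x hx => mem_coneOver.2 ⟨x, rfl, ?_⟩⟩
    obtain ⟨⟨u, hu, hux⟩, hxS⟩ := And.imp_left mem_coneOver.1 hx
    obtain ⟨-, huz, hul⟩ := (mem_setD hε).1 hu
    rw [hul, sub_zero] at hux
    have hz : ‖zPart (base x)‖ ≤ Δ * x (Fin.last _) := by
      have h1 : zPart (base x - base u) = zPart (base x) - zPart (base u) := rfl
      rw [huz, sub_zero] at h1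
      exact h1 ▸ (norm_zPart_le _).trans hux
    have hΔ0 : 0 < Δ := by linarith
    have hx0 : 0 ≤ x (Fin.last _) :=
      nonneg_of_mul_nonneg_right ((norm_nonneg _).trans hux) hΔ0
    rw [norm_base_coneMap_sub, coneMap_last]
    rcases hx0.eq_or_lt with h0 | hpos
    · rw [← h0, mul_zero] at hz
      rw [← h0, le_antisymm hz (norm_nonneg _)]
      simp
    · have hQ : 0 ≤ ev (polQ (thicken g ε) G) x := by
        by_contra hcon
        refine hxS (mem_setS.2 ⟨_, hpos, le_rfl, ?_⟩)
        rw [point_base_last]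
        linarith
      have hA := one_le_ev_polA P _ x hQ
      rw [ev_polB]
      refine abs_sub_one_mul_le hδ hA hpos.le hz ?_
      rw [div_le_iff₀ hδ] at hk₀
      have : (k₀ : ℝ) ≤ k := by exact_mod_cast (le_max_right _ _).trans hk
      nlinarith
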